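/- All graphs are finite and simple. For a graph $G$ with $n$ vertices, let $X_G=\sum_{\kappa}\prod_{v\in V(G)}x_{\kappa(v)}$, summed over all proper colorings $\kappa:V(G)\to\mathbb{Z}^{+}$, be its chromatic symmetric function (a power series over $\mathbb{Q}$ in $x_1,x_2,\dots$), and let $\mathrm{Part}(G)\vdash n$ be the partition formed by the numbers of vertices of the connected components of $G$. For partitions $\mu,\lambda\vdash n$, say that $\mu$ is finer than $\lambda$ ($\mu\le\lambda$) if the parts of $\mu$ can be grouped into blocks such that replacing each block by its sum gives $\lambda$. Let $B=\{X_{G_\lambda}\mid\lambda\vdash n\}$ be a forest-basis: to every partition $\lambda\vdash n$ there is assigned a forest $G_\lambda$ with $\mathrm{Part}(G_\lambda)=\lambda$. Then the following hold for every graph $G$ with $n$ vertices. 0. The family $(X_{G_\mu})_{\mu\vdash n}$ is linearly independent over $\mathbb{Q}$ and $X_G$ lies in its $\mathbb{Q}$-span, so that there are unique coefficients $[\mu]X_{G,B}\in\mathbb{Q}$ with $X_G=\sum_{\mu\vdash n}[\mu]X_{G,B}\,X_{G_\mu}$. 1. If $\mu\vdash n$ and $[\mu]X_{G,B}\neq 0$,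 then $\mu\le\mathrm{Part}(G)$. 2. If $G=F$ is a forest with $\mathrm{Part}(F)=\lambda$, then $[\lambda]X_{F,B}=1$. -/

import Mathlib

universe u v

namespace ForestBasis

/-- The monomial `∏ᵥ x_{κ v}`, recorded by its exponent vector. -/
noncomputable def colorMonomial {V : Type v} [Fintype V] (κ : V → ℕ+) : ℕ+ →₀ ℕ :=
  ∑ v, Finsupp.single (κ v) 1

/-- Only finitely many colorings have a given monomial, so the coefficients of the chromatic
symmetric function below are honest cardinalities. -/
theorem finite_colorings {V : Type v} [Fintype V] (G : SimpleGraph V) (m : ℕ+ →₀ ℕ) :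
    Finite {κ : G.Coloring ℕ+ // colorMonomial (fun v => κ v) = m} := by
  classical
  refine Finite.of_injective
    (β := V → m.support)
    (fun κ v => ⟨κ.1 v, ?_⟩) ?_
  · rw [Finsupp.mem_support_iff]
    intro h
    have h0 := DFunLike.congr_fun κ.2 (κ.1 v)
    rw [h, colorMonomial, Finsupp.finsetSum_apply] at h0
    have h1 := (Finset.sum_eq_zero_iff.mp h0) v (Finset.mem_univ v)
    simp at h1
  · intro κ κ' h
    apply Subtype.ext
    apply DFunLike.ext
    intro v
    exact congrArg Subtype.val (congrFun h v)

/-- The chromatic symmetric function `X_G = ∑_κ ∏ᵥ x_{κ v}`, the sum over all proper colorings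
`κ : V → ℤ⁺`, as a formal power series over `ℚ` in the variables `x₁, x₂, …`: the coefficient of
a monomial is the number of proper colorings with that monomial. -/
noncomputable def csf {V : Type v} [Fintype V] (G : SimpleGraph V) : MvPowerSeries ℕ+ ℚ :=
  fun m => (Nat.card {κ : G.Coloring ℕ+ // colorMonomial (fun v => κ v) = m} : ℚ)

open Classical in
/-- `Part(G)`: the partition of `n = |V|` formed by the sizes of the connected components. -/
noncomputable def part {V : Type v} [Fintype V] (G : SimpleGraph V) {n : ℕ}
    (hn : Fintype.card V = n) : n.Partition where
  parts := (Finset.univ : Finset G.ConnectedComponent).val.map fun c => c.supp.ncard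
  parts_pos := by
    intro i hi
    obtain ⟨c, -, rfl⟩ := Multiset.mem_map.mp hi
    exact (Set.ncard_pos (Set.toFinite _)).mpr c.nonempty_supp
  parts_sum := by
    change ∑ c : G.ConnectedComponent, c.supp.ncard = n
    rw [← hn, ← Finset.card_univ, Finset.card_eq_sum_card_fiberwise
      (f := G.connectedComponentMk) (t := Finset.univ) (by simp)]
    refine Finset.sum_congr rfl fun c _ => ?_
    rw [← Set.ncard_coe_finset]
    congr 1
    ext v
    simp

/-- `μ` is finer than `lam` (`μ ≤ lam`): the parts of `μ` can be grouped into blocks so that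
replacing each block by its sum gives `lam`. -/
def IsFiner {n : ℕ} (μ lam : n.Partition) : Prop :=
  ∃ S : Multiset (Multiset ℕ), S.join = μ.parts ∧ S.map Multiset.sum = lam.parts

/-- A chromatic-basis: an assignment of a graph `G_lam` with `Part(G_lam) = lam` to every
partition `lam` of `n`. The basis itself is the family `X_{G_lam}`, see `ChromaticBasis.elt`. -/
structure ChromaticBasis (n : ℕ) where
  V : n.Partition → Type u
  fintypeV : ∀ lam, Fintype (V lam)
  graph : ∀ lam, SimpleGraph (V lam)
  card_V : ∀ lam, Fintype.card (V lam) = n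
  part_graph : ∀ lam, part (graph lam) (card_V lam) = lam

attribute [instance] ChromaticBasis.fintypeV

namespace ChromaticBasis

variable {n : ℕ}

/-- The member `X_{G_lam}` of the chromatic-basis. -/
noncomputable def elt (B : ChromaticBasis.{u} n) (lam : n.Partition) : MvPowerSeries ℕ+ ℚ :=
  csf (B.graph lam)

/-- A forest-basis is a chromatic-basis all of whose graphs are forests. -/
def IsForestBasis (B : ChromaticBasis.{u} n) : Prop :=
  ∀ lam, (B.graph lam).IsAcyclic

/-- `c` is a list of coefficients expressing `X_G` in the chromatic-basis `B`. -/
def IsExpansion (B : ChromaticBasis.{u} n) {V : Type v} [Fintype V] (G : SimpleGraph V)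
    (c : n.Partition → ℚ) : Prop :=
  csf G = ∑ lam, c lam • B.elt lam

open Classical in
/-- The coefficient `[μ] X_{G,B}` of `X_{G_μ}` in the expression of `X_G` in `B` (with the junk
value `0` if there is no such expression). -/
noncomputable def coeff (B : ChromaticBasis.{u} n) {V : Type v} [Fintype V] (G : SimpleGraph V)
    (μ : n.Partition) : ℚ :=
  if h : ∃ c, B.IsExpansion G c then h.choose μ else 0

end ChromaticBasis

end ForestBasis

/-! Let `p_μ` denote the power sum symmetric functions. The proper colorings of `G` are those
without monochromatic edges, and the colorings that make every edge in a set `S` monochromatic are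
the maps on the components of the graph `(V, S)`. Inclusion–exclusion over the edges therefore gives
Stanley's expansion `X_G = ∑_{S ⊆ E(G)} (-1)^|S| p_{Part(V, S)}`, in which only partitions finer
than `Part(G)` occur. In a forest on `n` vertices the numbers of edges and of components add up to
`n`, so removing edges makes the partition strictly finer, and for a forest of type `λ` with `ℓ(λ)`
components the expansion is `(-1)^(n - ℓ(λ)) p_λ` plus terms strictly below `λ`. Hence a
forest-basis and the independent family of the `p_μ` are related by a triangular matrix with
diagonal entries `±1` for the refinement order, so spans over sets closed under refinement agree.
Since the sign depends only on `λ`, the leading terms of two forests of the same type cancel. -/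

namespace ForestBasis

section Triangular

variable {ι R M : Type*}

theorem linearIndependent_of_triangular [Ring R] [NoZeroDivisors R] [AddCommGroup M] [Module R M]
    [PartialOrder ι] {v : ι → M} (φ : ι → M →ₗ[R] R) (hdiag : ∀ i, φ i (v i) ≠ 0)
    (hle : ∀ i j, φ i (v j) ≠ 0 → j ≤ i) : LinearIndependent R v := by
  rw [linearIndependent_iff]
  intro c hc
  by_contra hne
  obtain ⟨i, hi⟩ := c.support.exists_minimal (Finsupp.support_nonempty_iff.mpr hne)
  have hci : c i ≠ 0 := Finsupp.mem_support_iff.mp hi.prop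
  have heval : c i * φ i (v i) = 0 := by
    rw [← map_zero (φ i), ← hc, Finsupp.linearCombination_apply, Finsupp.sum, map_sum,
      Finset.sum_eq_single_of_mem i hi.prop, map_smul, smul_eq_mul]
    intro j hj hji
    rw [map_smul, smul_eq_mul, mul_eq_zero]
    exact .inr (not_imp_comm.mp (hle i j) fun hji' => hji (hi.eq_of_le hj hji'))
  exact mul_ne_zero hci (hdiag i) heval

theorem mem_span_image_Iic_of_triangular [Ring R] [AddCommGroup M] [Module R M] [Preorder ι]
    [WellFoundedLT ι] {b x : ι → M} {u : ι → R} (hu : ∀ i, IsUnit (u i))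
    (hx : ∀ i, x i - u i • b i ∈ Submodule.span R (b '' Set.Iio i)) (i : ι) :
    b i ∈ Submodule.span R (x '' Set.Iic i) := by
  induction i using WellFoundedLT.induction with | ind i ih => ?_
  have hlower : Submodule.span R (b '' Set.Iio i) ≤ Submodule.span R (x '' Set.Iic i) := by
    rw [Submodule.span_le, Set.image_subset_iff]
    intro j hj
    exact Submodule.span_mono (Set.image_mono (Set.Iic_subset_Iic.mpr hj.le)) (ih j hj)
  have hxi : x i ∈ Submodule.span R (x '' Set.Iic i) :=
    Submodule.subset_span (Set.mem_image_of_mem x Set.self_mem_Iic)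
  have hub := Submodule.sub_mem _ hxi (hlower (hx i))
  rwa [sub_sub_cancel, Submodule.smul_mem_iff_of_isUnit _ (hu i)] at hub

theorem span_image_le_of_triangular [Ring R] [AddCommGroup M] [Module R M] [Preorder ι]
    [WellFoundedLT ι] {b x : ι → M} {u : ι → R} (hu : ∀ i, IsUnit (u i))
    (hx : ∀ i, x i - u i • b i ∈ Submodule.span R (b '' Set.Iio i)) {s : Set ι}
    (hs : IsLowerSet s) : Submodule.span R (b '' s) ≤ Submodule.span R (x '' s) := by
  rw [Submodule.span_le, Set.image_subset_iff]
  intro i hi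
  exact Submodule.span_mono (Set.image_mono (hs.Iic_subset hi))
    (mem_span_image_Iic_of_triangular hu hx i)

theorem linearIndependent_of_span_range_le [Finite ι] [Semiring R] [OrzechProperty R]
    [Nontrivial R] [AddCommMonoid M] [Module R M] {b x : ι → M} (hb : LinearIndependent R b)
    (hle : Submodule.span R (Set.range b) ≤ Submodule.span R (Set.range x)) :
    LinearIndependent R x := by
  have := Fintype.ofFinite ι
  have := Module.Finite.span_of_finite R (Set.finite_range x)
  rw [linearIndependent_iff_card_le_finrank_span,
    linearIndependent_iff_card_eq_finrank_span.mp hb]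
  exact Submodule.finrank_mono hle

theorem eq_zero_of_sum_mem_span_image [Fintype ι] [Semiring R] [AddCommMonoid M] [Module R M]
    {v : ι → M} (hv : LinearIndependent R v) {s : Set ι} {c : ι → R}
    (hc : ∑ i, c i • v i ∈ Submodule.span R (v '' s)) {i : ι} (hi : i ∉ s) : c i = 0 := by
  obtain ⟨d, hd, hdc⟩ := (Finsupp.mem_span_image_iff_linearCombination R).mp hc
  rw [Finsupp.linearCombination_apply, Finsupp.sum_fintype _ _ (by simp)] at hdc
  have hdc' : ⇑d = c := hv.fintypeLinearCombination_injective hdc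
  rw [← hdc']
  exact Finsupp.notMem_support_iff.mp fun h => hi (hd h)

end Triangular

section Refinement

theorem exists_equiv_of_map_univ_val_eq {ι κ α : Type*} [Fintype ι] [Fintype κ] {w : ι → α}
    {w' : κ → α} (h : Finset.univ.val.map w = Finset.univ.val.map w') :
    ∃ e : ι ≃ κ, ∀ i, w' (e i) = w i := by
  classical
  have hfiber (a : α) : Nonempty ({i // w i = a} ≃ {k // w' k = a}) := by
    rw [← Fintype.card_eq, Fintype.card_subtype, Fintype.card_subtype]
    simpa only [Multiset.count_map, Finset.card_def, Finset.filter_val, eq_comm] using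
      congrArg (Multiset.count a) h
  exact ⟨Equiv.ofFiberEquiv fun a => (hfiber a).some, Equiv.ofFiberEquiv_map _⟩

theorem sum_singleton_eq_map_val {ι α : Type*} (s : Finset ι) (w : ι → α) :
    ∑ i ∈ s, ({w i} : Multiset α) = s.val.map w := by
  rw [Finset.sum_eq_multiset_sum, ← Multiset.sum_map_singleton (s.val.map w), Multiset.map_map]
  rfl

theorem mapDomain_eq_sum_single {ι κ A : Type*} [Fintype ι] [AddCommMonoid A] (f : ι → κ)
    (w : ι →₀ A) : w.mapDomain f = ∑ i, Finsupp.single (f i) (w i) :=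
  Finsupp.sum_fintype _ _ fun i => Finsupp.single_zero (f i)

theorem mapDomain_apply_eq_sum_fiber {ι κ A : Type*} [Fintype ι] [DecidableEq κ] [AddCommMonoid A]
    (f : ι → κ) (w : ι →₀ A) (k : κ) : w.mapDomain f k = ∑ i with f i = k, w i := by
  rw [mapDomain_eq_sum_single, Finsupp.finsetSum_apply, Finset.sum_filter]
  simp only [Finsupp.single_apply]

variable {n : ℕ} {μ ν lam : n.Partition} {ι κ : Type*} [Fintype ι] [Fintype κ] {w : ι →₀ ℕ}
  {w' : κ →₀ ℕ}

theorem isFiner_of_mapDomain_eq (hw : Finset.univ.val.map w = μ.parts)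
    (hw' : Finset.univ.val.map w' = lam.parts) {f : ι → κ} (hf : w.mapDomain f = w') :
    IsFiner μ lam := by
  classical
  refine ⟨Finset.univ.val.map fun k => ∑ i with f i = k, {w i}, ?_, ?_⟩
  · rw [← hw, Multiset.join, Finset.sum_map_val, Finset.sum_fiberwise Finset.univ f,
      sum_singleton_eq_map_val]
  · rw [← hw', Multiset.map_map]
    refine Multiset.map_congr rfl fun k _ => ?_
    rw [← hf, mapDomain_apply_eq_sum_fiber, Function.comp_apply, sum_singleton_eq_map_val,
      Finset.sum_map_val]

theorem IsFiner.exists_mapDomain_eq (h : IsFiner μ lam)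
    (hw : Finset.univ.val.map w = μ.parts) (hw' : Finset.univ.val.map w' = lam.parts) :
    ∃ f : ι → κ, w.mapDomain f = w' := by
  classical
  obtain ⟨S, hS, hS'⟩ := h
  obtain ⟨e, he⟩ : ∃ e : (Σ s : S.ToType, s.1.ToType) ≃ ι, ∀ x, w (e x) = x.2.1 := by
    refine exists_equiv_of_map_univ_val_eq ?_
    rw [hw, ← hS, ← sum_singleton_eq_map_val, Fintype.sum_sigma]
    simp only [sum_singleton_eq_map_val, Multiset.map_univ_coe]
    rw [← Finset.sum_map_val, Multiset.map_univ_coe, Multiset.join]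
  obtain ⟨e', he'⟩ : ∃ e' : S.ToType ≃ κ, ∀ s, w' (e' s) = s.1.sum := by
    refine exists_equiv_of_map_univ_val_eq ?_
    rw [hw', ← hS', ← Multiset.map_univ S]
  refine ⟨fun i => e' (e.symm i).1, Finsupp.ext fun k => ?_⟩
  obtain ⟨s, rfl⟩ := e'.surjective k
  rw [mapDomain_apply_eq_sum_fiber, he', Finset.sum_filter, ← e.sum_comp, Fintype.sum_sigma,
    Fintype.sum_eq_single s]
  · simpa only [e.symm_apply_apply, he, if_true, Finset.sum_map_val] using
      congrArg Multiset.sum (Multiset.map_univ_coe s.1)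
  · intro t hts
    simp only [e.symm_apply_apply, e'.injective.eq_iff, hts, if_false, Finset.sum_const_zero]

/-- The parts of `μ` as a weight on `μ.parts.ToType`, the parts counted with multiplicity. In these
terms, grouping parts into blocks and summing each block is `Finsupp.mapDomain` along a map sending
each part to its block. -/
noncomputable def partWeight (μ : n.Partition) : μ.parts.ToType →₀ ℕ :=
  Finsupp.equivFunOnFinite.symm fun i => i.1

theorem map_partWeight (μ : n.Partition) : Finset.univ.val.map (partWeight μ) = μ.parts :=
  Multiset.map_univ_coe μ.parts

theorem partWeight_ne_zero (i : μ.parts.ToType) : partWeight μ i ≠ 0 :=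
  (μ.parts_pos Multiset.coe_mem).ne'

theorem isFiner_iff_exists_mapDomain_partWeight :
    IsFiner μ lam ↔ ∃ f, (partWeight μ).mapDomain f = partWeight lam :=
  ⟨fun h => h.exists_mapDomain_eq (map_partWeight μ) (map_partWeight lam),
    fun ⟨_, hf⟩ => isFiner_of_mapDomain_eq (map_partWeight μ) (map_partWeight lam) hf⟩

theorem IsFiner.refl (μ : n.Partition) : IsFiner μ μ :=
  isFiner_iff_exists_mapDomain_partWeight.mpr ⟨id, Finsupp.mapDomain_id⟩

theorem IsFiner.trans (h₁ : IsFiner μ ν) (h₂ : IsFiner ν lam) : IsFiner μ lam := by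
  rw [isFiner_iff_exists_mapDomain_partWeight] at h₁ h₂ ⊢
  obtain ⟨f, hf⟩ := h₁
  obtain ⟨g, hg⟩ := h₂
  exact ⟨g ∘ f, by rw [Finsupp.mapDomain_comp, hf, hg]⟩

theorem IsFiner.exists_surjective (h : IsFiner μ lam) :
    ∃ f : μ.parts.ToType → lam.parts.ToType, f.Surjective ∧
      (partWeight μ).mapDomain f = partWeight lam := by
  obtain ⟨f, hf⟩ := isFiner_iff_exists_mapDomain_partWeight.mp h
  refine ⟨f, fun k => ?_, hf⟩
  exact Finsupp.mem_range_of_mapDomain_ne_zero (hf ▸ partWeight_ne_zero k)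

theorem IsFiner.antisymm (h₁ : IsFiner μ lam) (h₂ : IsFiner lam μ) : μ = lam := by
  obtain ⟨f, hfsurj, hf⟩ := h₁.exists_surjective
  obtain ⟨g, hgsurj, -⟩ := h₂.exists_surjective
  have hfbij : f.Bijective := (Fintype.bijective_iff_surjective_and_card f).mpr
    ⟨hfsurj, (Fintype.card_le_of_surjective g hgsurj).antisymm
      (Fintype.card_le_of_surjective f hfsurj)⟩
  have hweight : partWeight lam ∘ f = partWeight μ := funext fun i => by
    rw [Function.comp_apply, ← hf, Finsupp.mapDomain_apply hfbij.injective]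
  refine Nat.Partition.ext ?_
  rw [← map_partWeight μ, ← map_partWeight lam, ← hweight, ← Multiset.map_map]
  exact congrArg _ (Multiset.map_univ_val_equiv (Equiv.ofBijective f hfbij))

/-- The refinement order on the partitions of `n`, with `μ ≤ lam` if `μ` is finer than `lam`. -/
scoped instance refinementOrder (n : ℕ) : PartialOrder n.Partition where
  le := IsFiner
  le_refl := IsFiner.refl
  le_trans _ _ _ := IsFiner.trans
  le_antisymm _ _ := IsFiner.antisymm

end Refinement

section PowerSum

open MvPowerSeries

theorem mapDomain_apply_apply_ne_zero {ι σ : Type*} {w : ι →₀ ℕ} {i : ι} (hi : w i ≠ 0)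
    (κ : ι → σ) : w.mapDomain κ (κ i) ≠ 0 := by
  classical
  rw [← Finsupp.mem_support_iff, Finsupp.mapDomain_support_of_subsingletonAddUnits]
  exact Finset.mem_image_of_mem κ (Finsupp.mem_support_iff.mpr hi)

theorem finite_mapDomain_eq {ι σ : Type*} [Finite ι] {w : ι →₀ ℕ} (hw : ∀ i, w i ≠ 0)
    (m : σ →₀ ℕ) : Finite {κ : ι → σ // w.mapDomain κ = m} := by
  have hmem (κ : {κ : ι → σ // w.mapDomain κ = m}) (i : ι) : m (κ.1 i) ≠ 0 :=
    fun h => mapDomain_apply_apply_ne_zero (hw i) κ.1 (κ.2.symm ▸ h)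
  refine Finite.of_injective (β := ι → m.support)
    (fun κ i => ⟨κ.1 i, Finsupp.mem_support_iff.mpr (hmem κ i)⟩) fun κ κ' h => ?_
  exact Subtype.ext (funext fun i => congrArg Subtype.val (congrFun h i))

variable (σ R : Type*) [CommSemiring R]

open Classical in
/-- The power sum symmetric function `p_k = ∑_c x_c ^ k` in variables indexed by `σ`, given by its
coefficients because `σ` may be infinite. For `k = 0` and nonempty `σ` it is `1`. -/
noncomputable def psum (k : ℕ) : MvPowerSeries σ R :=
  fun m => if ∃ c, Finsupp.single c k = m then 1 else 0

/-- The power sum symmetric function `p_μ`, the product of the `p_k` over the parts `k` of `μ`. -/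
noncomputable def psumPart {n : ℕ} (μ : n.Partition) : MvPowerSeries σ R :=
  (μ.parts.map (psum σ R)).prod

variable {σ R}

open Classical in
theorem coeff_psum (k : ℕ) (m : σ →₀ ℕ) :
    coeff m (psum σ R k) = if ∃ c, Finsupp.single c k = m then 1 else 0 :=
  rfl

theorem coeff_prod_psum {ι : Type*} [Fintype ι] {w : ι →₀ ℕ} (hw : ∀ i, w i ≠ 0) (m : σ →₀ ℕ) :
    coeff m (∏ i, psum σ R (w i)) = Nat.card {κ : ι → σ // w.mapDomain κ = m} := by
  classical
  rw [coeff_prod]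
  simp only [coeff_psum, Fintype.prod_boole, Finset.sum_boole]
  rw [← Nat.card_eq_finsetCard]
  let single (κ : {κ : ι → σ // w.mapDomain κ = m}) : ι →₀ σ →₀ ℕ :=
    Finsupp.equivFunOnFinite.symm fun i => .single (κ.1 i) (w i)
  have hmem (κ) : single κ ∈ Finset.univ.finsuppAntidiag m :=
    Finset.mem_finsuppAntidiag.mpr
      ⟨(mapDomain_eq_sum_single κ.1 w).symm.trans κ.2, Finset.subset_univ _⟩
  refine congrArg Nat.cast (Nat.card_eq_of_bijective
    (fun κ => ⟨single κ, Finset.mem_filter.mpr ⟨hmem κ, fun i => ⟨κ.1 i, rfl⟩⟩⟩) ⟨?_, ?_⟩).symm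
  · intro κ κ' h
    refine Subtype.ext (funext fun i => Finsupp.single_left_injective (hw i) ?_)
    exact DFunLike.congr_fun (congrArg Subtype.val h) i
  · rintro ⟨l, hl⟩
    obtain ⟨hl, hsingle⟩ := Finset.mem_filter.mp hl
    choose κ hκ using hsingle
    refine ⟨⟨κ, ?_⟩, Subtype.ext (Finsupp.ext hκ)⟩
    rw [mapDomain_eq_sum_single, Fintype.sum_congr _ _ hκ]
    exact (Finset.mem_finsuppAntidiag.mp hl).1

variable {n : ℕ} {μ ν : n.Partition}

theorem coeff_psumPart {ι : Type*} [Fintype ι] {w : ι →₀ ℕ}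
    (hw : Finset.univ.val.map w = μ.parts) (m : σ →₀ ℕ) :
    coeff m (psumPart σ R μ) = Nat.card {κ : ι → σ // w.mapDomain κ = m} := by
  have hpos (i : ι) : w i ≠ 0 :=
    (μ.parts_pos (hw ▸ Multiset.mem_map_of_mem w (Finset.mem_univ i))).ne'
  rw [← coeff_prod_psum hpos, psumPart, ← hw, Multiset.map_map]
  rfl

theorem le_of_coeff_psumPart_ne_zero {e : μ.parts.ToType → σ} (he : e.Injective)
    (h : coeff ((partWeight μ).mapDomain e) (psumPart σ R ν) ≠ 0) : ν ≤ μ := by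
  rw [coeff_psumPart (map_partWeight ν)] at h
  obtain ⟨κ, hκ⟩ : Nonempty {κ // (partWeight ν).mapDomain κ = (partWeight μ).mapDomain e} := by
    by_contra hempty
    rw [not_nonempty_iff] at hempty
    exact h (by rw [Nat.card_of_isEmpty, Nat.cast_zero])
  have hrange (i : ν.parts.ToType) : ∃ j, e j = κ i := by
    have hκi := mapDomain_apply_apply_ne_zero (partWeight_ne_zero i) κ
    exact Finsupp.mem_range_of_mapDomain_ne_zero (hκ ▸ hκi)
  choose f hf using hrange
  obtain rfl : e ∘ f = κ := funext hf
  refine isFiner_iff_exists_mapDomain_partWeight.mpr ⟨f, Finsupp.mapDomain_injective he ?_⟩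
  rw [← Finsupp.mapDomain_comp, hκ]

theorem coeff_psumPart_self_ne_zero [CharZero R] (e : μ.parts.ToType → σ) :
    coeff ((partWeight μ).mapDomain e) (psumPart σ R μ) ≠ 0 := by
  rw [coeff_psumPart (map_partWeight μ), Nat.cast_ne_zero]
  have := finite_mapDomain_eq (partWeight_ne_zero (μ := μ)) ((partWeight μ).mapDomain e)
  have : Nonempty {κ // (partWeight μ).mapDomain κ = (partWeight μ).mapDomain e} := ⟨⟨e, rfl⟩⟩
  exact Nat.card_pos.ne'

theorem linearIndependent_psumPart (σ R : Type*) [Infinite σ] [CommRing R] [NoZeroDivisors R]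
    [CharZero R] (n : ℕ) :
    LinearIndependent R (psumPart σ R : n.Partition → MvPowerSeries σ R) := by
  let e (μ : n.Partition) : μ.parts.ToType ↪ σ :=
    (Fintype.equivFin _).toEmbedding.trans (Fin.valEmbedding.trans (Infinite.natEmbedding σ))
  exact linearIndependent_of_triangular
    (fun μ => coeff ((partWeight μ).mapDomain (e μ)))
    (fun μ => coeff_psumPart_self_ne_zero (e μ))
    fun μ ν => le_of_coeff_psumPart_ne_zero (e μ).injective

end PowerSum

section Components

open SimpleGraph

variable {V : Type*} [Fintype V] {n : ℕ}

/-- The sizes of the connected components of `G`, as a weight on the components. -/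
noncomputable def componentSize (G : SimpleGraph V) : G.ConnectedComponent →₀ ℕ :=
  ∑ v, Finsupp.single (G.connectedComponentMk v) 1

theorem componentSize_apply (G : SimpleGraph V) (c : G.ConnectedComponent) :
    componentSize G c = c.supp.ncard := by
  classical
  simp only [componentSize, Finsupp.finsetSum_apply, Finsupp.single_apply, Finset.sum_boole,
    Nat.cast_id]
  rw [← Set.ncard_coe_finset, Finset.coe_filter_univ]
  rfl

theorem mapDomain_componentSize (G : SimpleGraph V) {A : Type*} (f : G.ConnectedComponent → A) :
    (componentSize G).mapDomain f = ∑ v, Finsupp.single (f (G.connectedComponentMk v)) 1 := by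
  simp only [componentSize, Finsupp.mapDomain_finsetSum, Finsupp.mapDomain_single]

theorem mapDomain_componentSize_of_le {H G : SimpleGraph V} (hle : H ≤ G) :
    (componentSize H).mapDomain (.map (.ofLE hle)) = componentSize G :=
  mapDomain_componentSize H _

theorem map_componentSize (G : SimpleGraph V) [Fintype G.ConnectedComponent]
    (hn : Fintype.card V = n) :
    Finset.univ.val.map (componentSize G) = (part G hn).parts := by
  simp only [part, componentSize_apply]
  congr!

theorem card_parts_part (G : SimpleGraph V) (hn : Fintype.card V = n) :
    (part G hn).parts.card = Nat.card G.ConnectedComponent := by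
  classical
  simp only [part, Multiset.card_map, Finset.card_val, Finset.card_univ, Nat.card_eq_fintype_card]

theorem part_mono (hn : Fintype.card V = n) : Monotone fun G : SimpleGraph V => part G hn := by
  classical
  exact fun H G hle => isFiner_of_mapDomain_eq (map_componentSize H hn) (map_componentSize G hn)
    (mapDomain_componentSize_of_le hle)

end Components

section PowerSumExpansion

open SimpleGraph MvPowerSeries

theorem eq_of_reachable_of_forall_adj {V C : Type*} {H : SimpleGraph V} {κ : V → C}
    (hκ : ∀ u v, H.Adj u v → κ u = κ v) {u v : V} (huv : H.Reachable u v) : κ u = κ v := by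
  rw [reachable_iff_reflTransGen] at huv
  induction huv with
  | refl => rfl
  | tail _ hadj heq => exact heq.trans (hκ _ _ hadj)

/-- Maps that are constant along the edges of `H` correspond to maps on the components of `H`. -/
def constOnAdjEquiv {V : Type*} (H : SimpleGraph V) (C : Type*) :
    {κ : V → C // ∀ u v, H.Adj u v → κ u = κ v} ≃ (H.ConnectedComponent → C) where
  toFun κ := ConnectedComponent.lift κ.1
    fun _ _ p _ => eq_of_reachable_of_forall_adj κ.2 p.reachable
  invFun f := ⟨f ∘ H.connectedComponentMk,
    fun _ _ h => congrArg f (ConnectedComponent.sound h.reachable)⟩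
  left_inv _ := rfl
  right_inv _ := funext fun c => c.ind fun _ => rfl

variable {V : Type*} [Fintype V] {n : ℕ} (hn : Fintype.card V = n)

theorem finite_colorMonomial_eq (m : ℕ+ →₀ ℕ) : Finite {κ : V → ℕ+ // colorMonomial κ = m} :=
  have := finite_colorings (⊥ : SimpleGraph V) m
  .of_surjective
    (fun κ : {κ : (⊥ : SimpleGraph V).Coloring ℕ+ // colorMonomial (fun v => κ v) = m} =>
      ⟨fun v => κ.1 v, κ.2⟩)
    fun κ => ⟨⟨Coloring.mk κ.1 fun h => h.elim, κ.2⟩, rfl⟩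

theorem coeff_psumPart_part (H : SimpleGraph V) (m : ℕ+ →₀ ℕ) :
    coeff m (psumPart ℕ+ ℚ (part H hn)) =
      Nat.card {κ : V → ℕ+ // colorMonomial κ = m ∧ ∀ u v, H.Adj u v → κ u = κ v} := by
  classical
  rw [coeff_psumPart (map_componentSize H hn)]
  simp only [and_comm (a := colorMonomial _ = m)]
  refine congrArg Nat.cast (Nat.card_congr ?_)
  refine (((constOnAdjEquiv H ℕ+).symm.subtypeEquiv fun f => ?_).trans
    (Equiv.subtypeSubtypeEquivSubtypeInter _ fun κ : V → ℕ+ => colorMonomial κ = m))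
  rw [mapDomain_componentSize]
  rfl

theorem coeff_csf (G : SimpleGraph V) (m : ℕ+ →₀ ℕ) :
    coeff m (csf G) =
      Nat.card {κ : V → ℕ+ // colorMonomial κ = m ∧ ∀ u v, G.Adj u v → κ u ≠ κ v} :=
  congrArg Nat.cast (Nat.card_congr ⟨fun κ => ⟨κ.1, κ.2, fun _ _ h => κ.1.valid h⟩,
    fun κ => ⟨Coloring.mk κ.1 (κ.2.2 _ _), κ.2.1⟩, fun _ => rfl, fun _ => rfl⟩)

theorem card_subtype_and_eq_card {A : Type*} {p q : A → Prop} (s : Finset {a // p a})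
    (hs : ∀ a, a ∈ s ↔ q a) : Nat.card {a // p a ∧ q a} = s.card :=
  (Nat.card_congr (Equiv.subtypeSubtypeEquivSubtypeInter p q).symm).trans (Nat.subtype_card s hs)

theorem forall_adj_ne_iff_forall_not_isDiag {V C : Type*} {G : SimpleGraph V} {κ : V → C} :
    (∀ u v, G.Adj u v → κ u ≠ κ v) ↔ ∀ e ∈ G.edgeSet, ¬ (e.map κ).IsDiag := by
  simp only [Sym2.forall, mem_edgeSet, Sym2.map_mk, Sym2.mk_isDiag_iff, ne_eq]

theorem forall_fromEdgeSet_adj_eq_iff_forall_isDiag {V C : Type*} {S : Set (Sym2 V)} {κ : V → C} :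
    (∀ u v, (fromEdgeSet S).Adj u v → κ u = κ v) ↔ ∀ e ∈ S, (e.map κ).IsDiag := by
  simp only [Sym2.forall, fromEdgeSet_adj, Sym2.map_mk, Sym2.mk_isDiag_iff, and_imp]
  exact forall₃_congr fun u v _ => ⟨fun h => by_contra fun hne => hne (h (ne_of_apply_ne κ hne)),
    fun h _ => h⟩

theorem csf_eq_sum_psumPart (G : SimpleGraph V) [Fintype G.edgeSet] :
    csf G = ∑ S ∈ G.edgeFinset.powerset,
      (-1 : ℚ) ^ S.card • psumPart ℕ+ ℚ (part (fromEdgeSet (S : Set (Sym2 V))) hn) := by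
  classical
  ext m
  have := finite_colorMonomial_eq (V := V) m
  have := Fintype.ofFinite {κ : V → ℕ+ // colorMonomial κ = m}
  let mono (e : Sym2 V) : Finset {κ : V → ℕ+ // colorMonomial κ = m} :=
    {κ | (e.map κ.1).IsDiag}
  have hcsf : coeff m (csf G) = (G.edgeFinset.inf fun e => (mono e)ᶜ).card := by
    rw [coeff_csf, card_subtype_and_eq_card _ fun κ => ?_]
    simp only [mono, Finset.mem_inf, Finset.mem_compl, Finset.mem_filter_univ, mem_edgeFinset,
      forall_adj_ne_iff_forall_not_isDiag]
  have hpsum (S : Finset (Sym2 V)) :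
      coeff m (psumPart ℕ+ ℚ (part (fromEdgeSet (S : Set (Sym2 V))) hn)) = (S.inf mono).card := by
    rw [coeff_psumPart_part, card_subtype_and_eq_card _ fun κ => ?_]
    simp only [mono, Finset.mem_inf, Finset.mem_filter_univ, Finset.mem_coe,
      forall_fromEdgeSet_adj_eq_iff_forall_isDiag]
  simp only [map_sum, map_smul, smul_eq_mul, hcsf, hpsum]
  exact_mod_cast Finset.inclusion_exclusion_card_inf_compl G.edgeFinset mono

end PowerSumExpansion

section Forest

open SimpleGraph

variable {V : Type*}

theorem fromEdgeSet_le_of_subset_edgeFinset {G : SimpleGraph V} [Fintype G.edgeSet]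
    {S : Finset (Sym2 V)} (hS : S ⊆ G.edgeFinset) : fromEdgeSet (S : Set (Sym2 V)) ≤ G :=
  fun _ _ h => mem_edgeFinset.mp (hS ((fromEdgeSet_adj _).mp h).1)

theorem fromEdgeSet_lt_of_ssubset_edgeFinset {G : SimpleGraph V} [Fintype G.edgeSet]
    {S : Finset (Sym2 V)} (hS : S ⊂ G.edgeFinset) : fromEdgeSet (S : Set (Sym2 V)) < G := by
  refine (fromEdgeSet_le_of_subset_edgeFinset hS.subset).lt_of_not_ge fun hle => hS.not_subset ?_
  rwa [le_fromEdgeSet_iff, ← coe_edgeFinset, Finset.coe_subset] at hle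

variable [Fintype V] {n : ℕ} (hn : Fintype.card V = n)

theorem sum_degree_supp_eq_sum_degree_induce (G : SimpleGraph V) [DecidableRel G.Adj]
    (c : G.ConnectedComponent) [DecidablePred (· ∈ c.supp)] :
    ∑ v : c.supp, G.degree v = ∑ v : c.supp, (G.induce c.supp).degree v := by
  refine Fintype.sum_congr _ _ fun v => ?_
  have h : G.neighborSet v ⊆ c.supp := fun w hw => c.mem_supp_of_adj_mem_supp v.2 hw
  convert (degree_induce_of_neighborSet_subset h).symm

theorem sum_sum_supp_eq_sum (G : SimpleGraph V) [Fintype G.ConnectedComponent]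
    [∀ c : G.ConnectedComponent, Fintype c.supp] {M : Type*} [AddCommMonoid M] (f : V → M) :
    ∑ c : G.ConnectedComponent, ∑ v : c.supp, f v = ∑ v, f v := by
  classical
  rw [← Fintype.sum_fiberwise G.connectedComponentMk f]
  congr!

theorem card_edgeFinset_add_card_connectedComponent_of_isAcyclic {F : SimpleGraph V}
    [DecidableRel F.Adj] (hF : F.IsAcyclic) :
    F.edgeFinset.card + Nat.card F.ConnectedComponent = Fintype.card V := by
  classical
  have htree (c : F.ConnectedComponent) :
      ∑ v : c.supp, F.degree v + 2 = ∑ _v : c.supp, 2 := by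
    have hc : (F.induce c.supp).IsTree := hF.isTree_connectedComponent c
    rw [sum_degree_supp_eq_sum_degree_induce, sum_degrees_eq_twice_card_edges, Finset.sum_const,
      Finset.card_univ, ← hc.card_edgeFinset, smul_eq_mul, add_mul, mul_comm]
  have hsum := Fintype.sum_congr _ _ htree
  rw [Finset.sum_add_distrib, sum_sum_supp_eq_sum F fun v => F.degree v,
    sum_degrees_eq_twice_card_edges, sum_sum_supp_eq_sum F fun _ => 2, Finset.sum_const,
    Finset.sum_const, Finset.card_univ, Finset.card_univ, ← Nat.card_eq_fintype_card] at hsum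
  lia

theorem part_lt_of_isAcyclic_of_lt {H F : SimpleGraph V} (hF : F.IsAcyclic) (hlt : H < F) :
    part H hn < part F hn := by
  classical
  refine (part_mono hn hlt.le).lt_of_ne fun (heq : part H hn = part F hn) => ?_
  have hcard : Nat.card H.ConnectedComponent = Nat.card F.ConnectedComponent := by
    rw [← card_parts_part H hn, heq, card_parts_part]
  have hedges := Finset.card_lt_card (edgeFinset_ssubset_edgeFinset.mpr hlt)
  have hcardH := card_edgeFinset_add_card_connectedComponent_of_isAcyclic (hF.anti hlt.le)
  have hcardF := card_edgeFinset_add_card_connectedComponent_of_isAcyclic hF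
  lia

theorem csf_mem_span_psumPart (G : SimpleGraph V) :
    csf G ∈ Submodule.span ℚ (psumPart ℕ+ ℚ '' Set.Iic (part G hn)) := by
  classical
  rw [csf_eq_sum_psumPart hn]
  refine Submodule.sum_mem _ fun S hS => Submodule.smul_mem _ _ (Submodule.subset_span ?_)
  exact Set.mem_image_of_mem _
    (part_mono hn (fromEdgeSet_le_of_subset_edgeFinset (Finset.mem_powerset.mp hS)))

theorem csf_sub_smul_psumPart_mem_span_of_isAcyclic {F : SimpleGraph V} (hF : F.IsAcyclic) :
    csf F - (-1 : ℚ) ^ (n - (part F hn).parts.card) • psumPart ℕ+ ℚ (part F hn) ∈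
      Submodule.span ℚ (psumPart ℕ+ ℚ '' Set.Iio (part F hn)) := by
  classical
  have hedges : n - (part F hn).parts.card = F.edgeFinset.card := by
    have hcard := card_edgeFinset_add_card_connectedComponent_of_isAcyclic hF
    rw [hn, ← card_parts_part F hn] at hcard
    lia
  rw [csf_eq_sum_psumPart hn, ← Finset.add_sum_erase _ _ (Finset.mem_powerset_self _),
    coe_edgeFinset, fromEdgeSet_edgeSet, hedges, add_sub_cancel_left]
  refine Submodule.sum_mem _ fun S hS => Submodule.smul_mem _ _ (Submodule.subset_span ?_)
  have hS : S ⊂ F.edgeFinset := Finset.mem_ssubsets.mp hS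
  exact Set.mem_image_of_mem _
    (part_lt_of_isAcyclic_of_lt hn hF (fromEdgeSet_lt_of_ssubset_edgeFinset hS))

end Forest

namespace ChromaticBasis

variable {n : ℕ} {B : ChromaticBasis.{u} n}

theorem IsForestBasis.elt_sub_smul_psumPart_mem_span (hB : B.IsForestBasis) (lam : n.Partition) :
    B.elt lam - (-1 : ℚ) ^ (n - lam.parts.card) • psumPart ℕ+ ℚ lam ∈
      Submodule.span ℚ (psumPart ℕ+ ℚ '' Set.Iio lam) := by
  have hmem := csf_sub_smul_psumPart_mem_span_of_isAcyclic (B.card_V lam) (hB lam)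
  rwa [B.part_graph] at hmem

theorem IsForestBasis.span_psumPart_le (hB : B.IsForestBasis) {s : Set n.Partition}
    (hs : IsLowerSet s) :
    Submodule.span ℚ (psumPart ℕ+ ℚ '' s) ≤ Submodule.span ℚ (B.elt '' s) :=
  span_image_le_of_triangular (fun lam => isUnit_neg_one.pow (n - lam.parts.card))
    hB.elt_sub_smul_psumPart_mem_span hs

theorem IsForestBasis.linearIndependent_elt (hB : B.IsForestBasis) :
    LinearIndependent ℚ B.elt := by
  refine linearIndependent_of_span_range_le (linearIndependent_psumPart ℕ+ ℚ n) ?_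
  simpa only [Set.image_univ] using hB.span_psumPart_le isLowerSet_univ

variable {V : Type v} [Fintype V]

theorem IsForestBasis.csf_mem_span_elt (hB : B.IsForestBasis) (hn : Fintype.card V = n)
    (G : SimpleGraph V) :
    csf G ∈ Submodule.span ℚ (B.elt '' Set.Iic (part G hn)) :=
  hB.span_psumPart_le (isLowerSet_Iic _) (csf_mem_span_psumPart hn G)

theorem IsForestBasis.csf_sub_elt_mem_span_of_isAcyclic (hB : B.IsForestBasis)
    (hn : Fintype.card V = n) {F : SimpleGraph V} (hF : F.IsAcyclic) :
    csf F - B.elt (part F hn) ∈ Submodule.span ℚ (B.elt '' Set.Iio (part F hn)) := by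
  refine hB.span_psumPart_le (isLowerSet_Iio _) ?_
  have hmem := Submodule.sub_mem _ (csf_sub_smul_psumPart_mem_span_of_isAcyclic hn hF)
    (hB.elt_sub_smul_psumPart_mem_span (part F hn))
  rwa [sub_sub_sub_cancel_right] at hmem

theorem IsForestBasis.isExpansion_coeff (hB : B.IsForestBasis) (hn : Fintype.card V = n)
    (G : SimpleGraph V) : B.IsExpansion G fun μ => B.coeff G μ := by
  have hspan := Submodule.span_mono (Set.image_subset_range _ _) (hB.csf_mem_span_elt hn G)
  obtain ⟨c, hc⟩ := (Submodule.mem_span_range_iff_exists_fun ℚ).mp hspan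
  have hex : ∃ c, B.IsExpansion G c := ⟨c, hc.symm⟩
  simpa only [coeff, dif_pos hex] using hex.choose_spec

theorem IsForestBasis.isFiner_part_of_coeff_ne_zero (hB : B.IsForestBasis)
    (hn : Fintype.card V = n) {G : SimpleGraph V} {μ : n.Partition} (hμ : B.coeff G μ ≠ 0) :
    IsFiner μ (part G hn) := by
  have hspan : ∑ μ, B.coeff G μ • B.elt μ ∈ Submodule.span ℚ (B.elt '' Set.Iic (part G hn)) :=
    hB.isExpansion_coeff hn G ▸ hB.csf_mem_span_elt hn G
  exact not_imp_comm.mp (eq_zero_of_sum_mem_span_image hB.linearIndependent_elt hspan) hμ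

theorem IsForestBasis.coeff_part_of_isAcyclic (hB : B.IsForestBasis) (hn : Fintype.card V = n)
    {F : SimpleGraph V} (hF : F.IsAcyclic) : B.coeff F (part F hn) = 1 := by
  classical
  have hspan : ∑ μ, (B.coeff F μ - (Pi.single (part F hn) 1 : n.Partition → ℚ) μ) • B.elt μ ∈
      Submodule.span ℚ (B.elt '' Set.Iio (part F hn)) := by
    simp only [sub_smul, Finset.sum_sub_distrib, Pi.single_apply, ite_smul, one_smul, zero_smul,
      Finset.sum_ite_eq', Finset.mem_univ, if_true]
    exact hB.isExpansion_coeff hn F ▸ hB.csf_sub_elt_mem_span_of_isAcyclic hn hF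
  have hzero := eq_zero_of_sum_mem_span_image hB.linearIndependent_elt hspan Set.self_notMem_Iio
  rwa [Pi.single_eq_same, sub_eq_zero] at hzero

end ChromaticBasis

end ForestBasis

theorem mainTheorem10 {n : ℕ} (B : ForestBasis.ChromaticBasis.{u} n) (hB : B.IsForestBasis)
    {V : Type v} [Fintype V] (G : SimpleGraph V) (hn : Fintype.card V = n) :
    (LinearIndependent ℚ B.elt ∧ B.IsExpansion G (fun μ => B.coeff G μ)) ∧
    (∀ μ : n.Partition, B.coeff G μ ≠ 0 → ForestBasis.IsFiner μ (ForestBasis.part G hn)) ∧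
    (G.IsAcyclic → B.coeff G (ForestBasis.part G hn) = 1) :=
  ⟨⟨hB.linearIndependent_elt, hB.isExpansion_coeff hn G⟩,
    fun _ => hB.isFiner_part_of_coeff_ne_zero hn,
    hB.coeff_part_of_isAcyclic hn⟩
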